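/- Let $0<s<1$, let $Q,P$ be irreducible $2\times2$ stochastic matrices (rows summing to $1$), and let $E$ be a $2\times 2$ matrix such that $$R=\begin{pmatrix} sQ & E\\ 0 & P\end{pmatrix}$$ is a stochastic matrix. Consider the urn with four colors (white, black, green, yellow) and replacement matrix $R$: the content after $n$ trials is a random row vector $C_n=(W_n,B_n,G_n,Y_n)$ in $\mathbb{R}_{\ge0}^4$; $C_0$ is a fixed probability vector with $W_0+B_0>0$; at trial $n+1$ a ball of color $i$ is drawn with conditional probability $C_{n,i}/(n+1)$ given $C_0,\dots,C_n$, and the $i$-th row of $R$ is then added to $C_n$ to give $C_{n+1}$. Assume that $R$ is not diagonalizable and that its repeated eigenvalue is $0$; that is, the eigenvalues other than $1$ of $Q$ and of $P$ are both $0$, and $R$ has eigenvalues $s,0,0,1$. Let $RT=TJ$ be a Jordan decomposition of $R$, where $T$ is nonsingular with columns $t_1,t_2,t_3,t_4$ and $$J=\begin{pmatrix} s&0&0&0\\0&0&1&0\\0&0&0&0\\0&0&0&1\end{pmatrix},$$ so that $Rt_2=0$ and $Rt_3=t_2$, where $t_2=(\xi',0,0)'$ with $\xi\in\mathbb{R}^2$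 an eigenvector of $Q$ for the eigenvalue $0$. Let $\pi_Q$ be the stationary distribution of $Q$, and let $\xi^2$ be the vector of squared coordinates of $\xi$. Then $(W_n+B_n)/n^s$ converges almost surely to a random variable $U$, and $$\frac{C_n t_3}{n^{s/2}}\Rightarrow N\!\left(0,\ \frac{\pi_Q\xi^2\,U}{s}\right),$$ a variance mixture of normal distributions: the limit is the law of $\sqrt{\pi_Q\xi^2\,U/s}\;Z$, where $Z$ is a standard normal variable independent of $U$. -/

import Mathlib

open MeasureTheory ProbabilityTheory Filter Topology Matrix

/-- Colors: `inl 0` white, `inl 1` black, `inr 0` green, `inr 1` yellow. -/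
abbrev Color : Type := Fin 2 ⊕ Fin 2

/-- The replacement matrix with diagonal blocks `s • Q`, `P`, upper right block `E` and lower left
block `0`. -/
def replacementMatrix (s : ℝ) (Q E P : Matrix (Fin 2) (Fin 2) ℝ) : Matrix Color Color ℝ :=
  Matrix.fromBlocks (s • Q) E 0 P

/-- `A` is diagonalizable over `ℝ`: it has a basis of eigenvectors, the columns of `S`. -/
def IsDiagonalizable {ι : Type*} [Fintype ι] [DecidableEq ι] (A : Matrix ι ι ℝ) : Prop :=
  ∃ (S : Matrix ι ι ℝ) (d : ι → ℝ), IsUnit S ∧ A * S = S * Matrix.diagonal d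

/-- `p` is a stationary distribution of the stochastic matrix `Q`. -/
def IsStationaryDistribution {ι : Type*} [Fintype ι] (Q : Matrix ι ι ℝ) (p : ι → ℝ) : Prop :=
  p ∈ stdSimplex ℝ ι ∧ p ᵥ* Q = p

/-- The Jordan form with eigenvalue `s`, a Jordan block of size two for the eigenvalue `0`, and
eigenvalue `1`; the columns are ordered `inl 0`, `inl 1`, `inr 0`, `inr 1`. -/
def jordanForm (s : ℝ) : Matrix Color Color ℝ :=
  Matrix.fromBlocks !![s, 0; 0, 0] !![0, 0; 1, 0] 0 !![0, 0; 0, 1]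

/-- The urn process with replacement matrix `R` and initial content `c₀` (total content `1`) on the
probability space `(Ω, μ)`. The vector `C n ω` is the content after `n` trials, and `draw n ω` is
the color drawn at trial `n + 1`. Given the history `C 0, …, C n`, color `i` is drawn at trial
`n + 1` with probability `C n i / (n + 1)`, and then row `i` of `R` is added to the urn. -/
structure IsUrnProcess {ι : Type*} {Ω : Type*} [MeasurableSpace Ω] (R : Matrix ι ι ℝ) (c₀ : ι → ℝ)
    (μ : Measure Ω) (draw : ℕ → Ω → ι) (C : ℕ → Ω → ι → ℝ) : Prop where
  measurableSet_draw : ∀ n i, MeasurableSet (draw n ⁻¹' {i})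
  zero : ∀ ω, C 0 ω = c₀
  succ : ∀ n ω, C (n + 1) ω = C n ω + R (draw n ω)
  condProb_draw : ∀ n i,
    μ[(draw n ⁻¹' {i}).indicator (fun _ => (1 : ℝ)) |
        ⨆ k ≤ n, MeasurableSpace.comap (C k) inferInstance]
      =ᵐ[μ] fun ω => C n ω i / ((n : ℝ) + 1)

/-! Since `Q` has eigenvalues 1 and 0, both its rows equal `πQ`. Every white or black draw therefore
adds the same vector `s • πQ` to the white-black part, whose content is an affine function of the
number `K` of such draws. As `R t₃ = (ξ, 0)`, the variable `C n ⬝ᵥ t₃` is its initial value plus the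
sum of `ξ` over the white and black draws. Whether a draw is white or black at all depends on the
past only through `K`. So, given the draw times, the colors at those draws are independent, and the
characteristic function of `C n ⬝ᵥ t₃` is exactly a phase times the expectation of a product of `K`
explicit two-point characteristic functions (`integral_cexp_content_mul`). The two-point laws
approach `πQ`, under which `ξ` has mean 0 and second moment `κ`, with error of order `1 / (j + 1)`.
The martingale attached to the eigenvalue `s` gives `K / n ^ s → U / s` almost surely, so the
product at `t / n ^ (s / 2)` tends to `exp (-t² κ U / (2 s))` (`tendsto_prod_twoPointCharFun`).
Dominated convergence and Lévy's continuity theorem finish the proof. -/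

/-! ### Linear algebra of the replacement matrix -/

/-- A kernel vector of a stochastic matrix is not constant. In dimension two, orthogonality to such
a `ξ` and total mass 1 determine a row, so the rows coincide; stationarity identifies the common row
with `p`. -/
lemma stochastic_row_eq_stationary {Q : Matrix (Fin 2) (Fin 2) ℝ}
    (hQ : Q ∈ Matrix.rowStochastic ℝ (Fin 2)) {ξ : Fin 2 → ℝ}
    (hξ : Module.End.HasEigenvector (Matrix.toLin' Q) 0 ξ)
    {p : Fin 2 → ℝ} (hp : IsStationaryDistribution Q p) :
    (∀ i, Q i = p) ∧ p ⬝ᵥ ξ = 0 := by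
  have hQξ : Q *ᵥ ξ = 0 := by simpa using hξ.apply_eq_smul
  have hsum := (Matrix.mem_rowStochastic_iff_sum.1 hQ).2
  have h0 := congrFun hQξ 0
  have h1 := congrFun hQξ 1
  have s0 := hsum 0
  have s1 := hsum 1
  simp only [Matrix.mulVec, dotProduct, Fin.sum_univ_two, Pi.zero_apply] at h0 h1 s0 s1
  have hne : ξ 0 - ξ 1 ≠ 0 := by
    intro h
    have e : ξ 1 = ξ 0 := by linarith
    rw [e, ← add_mul, s0, one_mul] at h0
    refine hξ.2 ?_
    ext i
    fin_cases i
    · simpa using h0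
    · simpa [e] using h0
  have e0 : Q 1 0 = Q 0 0 := by
    have e1 : Q 0 1 = 1 - Q 0 0 := by linarith
    have e2 : Q 1 1 = 1 - Q 1 0 := by linarith
    rw [e1] at h0
    rw [e2] at h1
    refine mul_right_cancel₀ hne ?_
    linarith
  have e1 : Q 1 1 = Q 0 1 := by linarith
  have hp1 := hp.1.2
  rw [Fin.sum_univ_two] at hp1
  have p0 : p 0 = Q 0 0 := by
    have := congrFun hp.2 0
    simp only [Matrix.vecMul, dotProduct, Fin.sum_univ_two, e0, ← add_mul, hp1, one_mul] at this
    exact this.symm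
  have p1 : p 1 = Q 0 1 := by linarith
  constructor
  · intro i
    ext j
    fin_cases i <;> fin_cases j <;> simp [*]
  · rw [dotProduct, Fin.sum_univ_two, p0, p1, h0]

lemma mulVec_jordan_col {A T : Matrix Color Color ℝ} {s : ℝ} (h : A * T = T * jordanForm s) :
    A *ᵥ T.col (Sum.inr 0) = T.col (Sum.inl 1) := by
  ext i
  have := congrFun (congrFun h i) (Sum.inr 0)
  rw [Matrix.mul_apply, Matrix.mul_apply] at this
  simp only [Matrix.mulVec, dotProduct, Matrix.col_apply]
  rw [this]
  simp [jordanForm, Fintype.sum_sum_type]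

/-! ### Products of two-point characteristic functions -/

/-- The characteristic function at `θ` of the value (`x` or `y`) of a color chosen in proportion to
the amounts `a + c j` and `b + d j`. -/
noncomputable def twoPointCharFun (a b c d x y θ : ℝ) (j : ℕ) : ℂ :=
  ((a + c * j : ℝ) * Complex.exp (θ * x * Complex.I) +
    (b + d * j : ℝ) * Complex.exp (θ * y * Complex.I)) / ((a + b + (c + d) * j : ℝ) : ℂ)

lemma norm_cexp_mul_I_sub_le (u : ℝ) :
    ‖Complex.exp (u * Complex.I) - (1 + u * Complex.I - u ^ 2 / 2)‖ ≤ |u| ^ 3 * Real.exp |u| := by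
  have := Complex.norm_exp_sub_sum_le_norm_mul_exp (u * Complex.I) 3
  simp only [norm_mul, Complex.norm_real, Complex.norm_I, mul_one, Real.norm_eq_abs] at this
  refine le_trans (le_of_eq ?_) this
  congr 2
  simp [Finset.sum_range_succ, mul_pow]
  ring

lemma norm_exp_neg_sub_le {v : ℝ} (hv : 0 ≤ v) :
    ‖Complex.exp (-v) - (1 - v)‖ ≤ v ^ 2 * Real.exp v := by
  have := Complex.norm_exp_sub_sum_le_norm_mul_exp (-v) 2
  simp only [norm_neg, Complex.norm_real, Real.norm_eq_abs, abs_of_nonneg hv] at this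
  refine le_trans (le_of_eq ?_) this
  congr 2
  simp [Finset.sum_range_succ]
  ring

lemma norm_cexp_mul_sub_le {θ x : ℝ} (hθ : |θ| ≤ 1) :
    ‖Complex.exp (θ * x * Complex.I) - (1 + θ * x * Complex.I - (θ * x) ^ 2 / 2)‖
      ≤ |x| ^ 3 * Real.exp |x| * |θ| ^ 3 := by
  have := norm_cexp_mul_I_sub_le (θ * x)
  push_cast at this
  refine this.trans ?_
  rw [abs_mul, mul_pow]
  have h1 : Real.exp (|θ| * |x|) ≤ Real.exp |x| :=
    Real.exp_le_exp.2 (mul_le_of_le_one_left (abs_nonneg _) hθ)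
  calc |θ| ^ 3 * |x| ^ 3 * Real.exp (|θ| * |x|) ≤ |θ| ^ 3 * |x| ^ 3 * Real.exp |x| := by gcongr
    _ = _ := by ring

/-- Second-order Taylor expansion of the three exponentials: constant terms cancel by `p + q = 1`,
the linear terms leave the mean, the quadratic ones the discrepancy between the second moment and
`κ`. -/
lemma norm_two_point_sub_exp_le {p q x y κ θ : ℝ} (hp : 0 ≤ p) (hq : 0 ≤ q) (hpq : p + q = 1)
    (hκ : 0 ≤ κ) (hθ : |θ| ≤ 1) :
    ‖(p * Complex.exp (θ * x * Complex.I) + q * Complex.exp (θ * y * Complex.I) : ℂ)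
        - Complex.exp (-(θ ^ 2 * κ / 2 : ℝ))‖
      ≤ |θ| * |p * x + q * y| + θ ^ 2 * |p * x ^ 2 + q * y ^ 2 - κ| +
        (|x| ^ 3 * Real.exp |x| + |y| ^ 3 * Real.exp |y| + κ ^ 2 * Real.exp κ) * |θ| ^ 3 := by
  have hx := norm_cexp_mul_sub_le (x := x) hθ
  have hy := norm_cexp_mul_sub_le (x := y) hθ
  have hv : 0 ≤ θ ^ 2 * κ / 2 := by positivity
  have hk := norm_exp_neg_sub_le hv
  have hθ2 : θ ^ 2 ≤ 1 := by rw [← sq_abs]; exact pow_le_one₀ (abs_nonneg _) hθ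
  have hk' : (θ ^ 2 * κ / 2) ^ 2 * Real.exp (θ ^ 2 * κ / 2) ≤ κ ^ 2 * Real.exp κ * |θ| ^ 3 := by
    have h1 : Real.exp (θ ^ 2 * κ / 2) ≤ Real.exp κ := Real.exp_le_exp.2 (by nlinarith)
    have h2 : (θ ^ 2 * κ / 2) ^ 2 ≤ κ ^ 2 * |θ| ^ 3 := by
      have h3 : |θ| ^ 4 ≤ |θ| ^ 3 := pow_le_pow_of_le_one (abs_nonneg _) hθ (by norm_num)
      have h4 : (θ ^ 2 * κ / 2) ^ 2 = κ ^ 2 * |θ| ^ 4 / 4 := by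
        rw [← sq_abs θ]; ring
      rw [h4]
      nlinarith [mul_le_mul_of_nonneg_left h3 (sq_nonneg κ), pow_nonneg (abs_nonneg θ) 4,
        mul_nonneg (sq_nonneg κ) (pow_nonneg (abs_nonneg θ) 4)]
    calc _ ≤ κ ^ 2 * |θ| ^ 3 * Real.exp κ := by gcongr
      _ = _ := by ring
  set ex := Complex.exp (θ * x * Complex.I) - (1 + θ * x * Complex.I - (θ * x) ^ 2 / 2) with hex
  set ey := Complex.exp (θ * y * Complex.I) - (1 + θ * y * Complex.I - (θ * y) ^ 2 / 2) with hey
  set ek := Complex.exp (-(θ ^ 2 * κ / 2 : ℝ)) - (1 - (θ ^ 2 * κ / 2 : ℝ)) with hek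
  have hpqC : (p : ℂ) + q = 1 := by exact_mod_cast hpq
  have key : (p * Complex.exp (θ * x * Complex.I) + q * Complex.exp (θ * y * Complex.I) : ℂ)
        - Complex.exp (-(θ ^ 2 * κ / 2 : ℝ))
      = ((θ * (p * x + q * y) : ℝ) : ℂ) * Complex.I
        - ((θ ^ 2 * (p * x ^ 2 + q * y ^ 2 - κ) / 2 : ℝ) : ℂ)
        + (p * ex + q * ey - ek) := by
    rw [hex, hey, hek]
    push_cast
    linear_combination hpqC
  rw [key]
  have n1 : ‖((θ * (p * x + q * y) : ℝ) : ℂ) * Complex.I‖ = |θ| * |p * x + q * y| := by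
    rw [norm_mul, Complex.norm_real, Complex.norm_I, mul_one, Real.norm_eq_abs, abs_mul]
  have n2 : ‖((θ ^ 2 * (p * x ^ 2 + q * y ^ 2 - κ) / 2 : ℝ) : ℂ)‖
      ≤ θ ^ 2 * |p * x ^ 2 + q * y ^ 2 - κ| := by
    rw [Complex.norm_real, Real.norm_eq_abs, abs_div, abs_mul, abs_of_nonneg (sq_nonneg θ),
      abs_two]
    exact half_le_self (by positivity)
  have n3 : ‖(p : ℂ) * ex‖ ≤ ‖ex‖ := by
    rw [norm_mul, Complex.norm_real, Real.norm_eq_abs, abs_of_nonneg hp]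
    exact mul_le_of_le_one_left (norm_nonneg _) (by linarith)
  have n4 : ‖(q : ℂ) * ey‖ ≤ ‖ey‖ := by
    rw [norm_mul, Complex.norm_real, Real.norm_eq_abs, abs_of_nonneg hq]
    exact mul_le_of_le_one_left (norm_nonneg _) (by linarith)
  have n5 := norm_sub_le ((p : ℂ) * ex + q * ey) ek
  have n6 := norm_add_le ((p : ℂ) * ex) (q * ey)
  refine (norm_add_le _ _).trans ?_
  have n7 := norm_sub_le (((θ * (p * x + q * y) : ℝ) : ℂ) * Complex.I)
    ((θ ^ 2 * (p * x ^ 2 + q * y ^ 2 - κ) / 2 : ℝ) : ℂ)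
  rw [n1] at n7
  nlinarith

/-- Lindeberg's telescoping: factors are exchanged one at a time, the others having norm at most 1.
-/
lemma norm_prod_sub_pow_le {f : ℕ → ℂ} {z : ℂ} (hf : ∀ j, ‖f j‖ ≤ 1) (hz : ‖z‖ ≤ 1) (K : ℕ) :
    ‖∏ j ∈ Finset.range K, f j - z ^ K‖ ≤ ∑ j ∈ Finset.range K, ‖f j - z‖ := by
  induction K with
  | zero => simp
  | succ K ih =>
    rw [Finset.prod_range_succ, Finset.sum_range_succ, pow_succ]
    have e : (∏ j ∈ Finset.range K, f j) * f K - z ^ K * z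
        = (∏ j ∈ Finset.range K, f j - z ^ K) * z + (∏ j ∈ Finset.range K, f j) * (f K - z) := by
      ring
    have hP : ‖∏ j ∈ Finset.range K, f j‖ ≤ 1 := by
      rw [norm_prod]
      exact Finset.prod_le_one (fun _ _ => norm_nonneg _) (fun j _ => hf j)
    rw [e]
    refine (norm_add_le _ _).trans (add_le_add ?_ ?_)
    · rw [norm_mul]
      exact (mul_le_of_le_one_right (norm_nonneg _) hz).trans ih
    · rw [norm_mul]
      exact mul_le_of_le_one_left (norm_nonneg _) hP

section TwoPoint

variable {a b c d x y : ℝ}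

lemma norm_twoPointCharFun_le_one (ha : 0 ≤ a) (hb : 0 ≤ b) (hc : 0 ≤ c) (hd : 0 ≤ d)
    (hab : 0 < a + b) (θ : ℝ) (j : ℕ) :
    ‖twoPointCharFun a b c d x y θ j‖ ≤ 1 := by
  have hpos : 0 < a + b + (c + d) * j := by positivity
  have h1 : ∀ u : ℝ, ‖Complex.exp (θ * u * Complex.I)‖ = 1 := fun u => by
    rw [← Complex.ofReal_mul, Complex.norm_exp_ofReal_mul_I]
  rw [twoPointCharFun, norm_div, Complex.norm_real, Real.norm_eq_abs, abs_of_pos hpos,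
    div_le_one hpos]
  refine (norm_add_le _ _).trans ?_
  rw [norm_mul, norm_mul, h1, h1, Complex.norm_real, Complex.norm_real, Real.norm_eq_abs,
    Real.norm_eq_abs, abs_of_nonneg (by positivity), abs_of_nonneg (by positivity)]
  linarith

/-- By `hmean` and the choice of `κ`, the terms proportional to `j` cancel in the mean and in the
centered second moment. What remains is a constant over `a + b + (c + d) * j`, of order `1 / (j +
1)`. -/
lemma norm_twoPointCharFun_sub_exp_le (ha : 0 ≤ a) (hb : 0 ≤ b) (hc : 0 ≤ c) (hd : 0 ≤ d)
    (hab : 0 < a + b) (hcd : 0 < c + d) (hmean : c * x + d * y = 0) :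
    ∃ A : ℝ, 0 ≤ A ∧ ∀ θ : ℝ, |θ| ≤ 1 → ∀ j : ℕ,
      ‖twoPointCharFun a b c d x y θ j
          - Complex.exp (-(θ ^ 2 * ((c * x ^ 2 + d * y ^ 2) / (c + d)) / 2 : ℝ))‖
        ≤ A * (|θ| * ((j : ℝ) + 1)⁻¹ + |θ| ^ 3) := by
  set κ := (c * x ^ 2 + d * y ^ 2) / (c + d) with hκ
  have hκ0 : 0 ≤ κ := by positivity
  set m := min (a + b) (c + d)
  have hm : 0 < m := lt_min hab hcd
  set A₁ := (|a * x + b * y| + |a * x ^ 2 + b * y ^ 2 - κ * (a + b)|) / m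
  set A₂ := |x| ^ 3 * Real.exp |x| + |y| ^ 3 * Real.exp |y| + κ ^ 2 * Real.exp κ
  have hA₁ : 0 ≤ A₁ := by positivity
  have hA₂ : 0 ≤ A₂ := by positivity
  refine ⟨A₁ + A₂, by positivity, fun θ hθ j => ?_⟩
  have hpos : 0 < a + b + (c + d) * j := by positivity
  have hD : m * ((j : ℝ) + 1) ≤ a + b + (c + d) * j := by
    have h1 : m ≤ a + b := min_le_left _ _
    have h2 : m ≤ c + d := min_le_right _ _
    nlinarith [mul_le_mul_of_nonneg_right h2 (Nat.cast_nonneg (α := ℝ) j)]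
  set D := a + b + (c + d) * j with hDdef
  have key := norm_two_point_sub_exp_le (p := (a + c * j) / D) (q := (b + d * j) / D)
    (x := x) (y := y) (κ := κ) (θ := θ) (by positivity) (by positivity)
    (by rw [← add_div, div_eq_one_iff_eq hpos.ne', hDdef]; ring) hκ0 hθ
  have e1 : (a + c * j) / D * x + (b + d * j) / D * y = (a * x + b * y) / D := by
    field_simp
    linear_combination (j : ℝ) * hmean
  have e2 : (a + c * j) / D * x ^ 2 + (b + d * j) / D * y ^ 2 - κ
      = (a * x ^ 2 + b * y ^ 2 - κ * (a + b)) / D := by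
    have : κ * (c + d) = c * x ^ 2 + d * y ^ 2 := by rw [hκ]; field_simp
    field_simp
    rw [hDdef]
    linear_combination -(j : ℝ) * this
  rw [e1, e2, abs_div, abs_div, abs_of_pos hpos] at key
  have e3 : twoPointCharFun a b c d x y θ j
      = (((a + c * j) / D : ℝ) * Complex.exp (θ * x * Complex.I)
        + ((b + d * j) / D : ℝ) * Complex.exp (θ * y * Complex.I) : ℂ) := by
    rw [twoPointCharFun, ← hDdef]
    push_cast
    ring
  rw [e3]
  refine key.trans ?_
  -- The second-moment error, of order `θ ^ 2 / (j + 1)`, is absorbed into the order of the mean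
  -- error.
  have hθ2 : θ ^ 2 ≤ |θ| := by
    rw [← sq_abs]; nlinarith [abs_nonneg θ]
  have h3 : ∀ u : ℝ, |u| / D ≤ |u| / m * ((j : ℝ) + 1)⁻¹ := fun u => by
    rw [div_mul_eq_mul_div, ← div_eq_mul_inv, div_div, mul_comm ((j : ℝ) + 1)]
    gcongr
  have h4 : |θ| * (|a * x + b * y| / D)
        + θ ^ 2 * (|a * x ^ 2 + b * y ^ 2 - κ * (a + b)| / D)
      ≤ A₁ * (|θ| * ((j : ℝ) + 1)⁻¹) := by
    calc _ ≤ |θ| * (|a * x + b * y| / m * ((j : ℝ) + 1)⁻¹)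
          + |θ| * (|a * x ^ 2 + b * y ^ 2 - κ * (a + b)| / m * ((j : ℝ) + 1)⁻¹) := by
          gcongr
          · exact h3 _
          · exact h3 _
      _ = _ := by ring
  have h5 : 0 ≤ A₂ * (|θ| * ((j : ℝ) + 1)⁻¹) := by positivity
  have h6 : 0 ≤ A₁ * |θ| ^ 3 := by positivity
  nlinarith

/-- With `θ` of order `n ^ (-s / 2)` and `K n` of order at most `n ^ s`, the summed errors are a
multiple of `|θ| * (1 + log n) + K n * |θ| ^ 3`, which vanishes; the power of the Gaussian factor
has the stated limit. -/
lemma tendsto_prod_twoPointCharFun (ha : 0 ≤ a) (hb : 0 ≤ b) (hc : 0 ≤ c) (hd : 0 ≤ d)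
    (hab : 0 < a + b) (hcd : 0 < c + d) (hmean : c * x + d * y = 0) {s u : ℝ} (hs : 0 < s)
    {K : ℕ → ℕ} (hK : ∀ n, K n ≤ n)
    (hKu : Tendsto (fun n : ℕ => (K n : ℝ) / (n : ℝ) ^ s) atTop (𝓝 u)) (t : ℝ) :
    Tendsto (fun n : ℕ => ∏ j ∈ Finset.range (K n),
        twoPointCharFun a b c d x y (t / (n : ℝ) ^ (s / 2)) j) atTop
      (𝓝 (Complex.exp (-(t ^ 2 * ((c * x ^ 2 + d * y ^ 2) / (c + d)) * u / 2 : ℝ)))) := by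
  obtain ⟨A, hA, hbound⟩ :=
    norm_twoPointCharFun_sub_exp_le (x := x) (y := y) ha hb hc hd hab hcd hmean
  set κ := (c * x ^ 2 + d * y ^ 2) / (c + d) with hκ
  have hκ0 : 0 ≤ κ := by positivity
  set θ : ℕ → ℝ := fun n => t / (n : ℝ) ^ (s / 2) with hθ
  have hnat : Tendsto (fun n : ℕ => (n : ℝ)) atTop atTop := tendsto_natCast_atTop_atTop
  have hθ0 : Tendsto θ atTop (𝓝 0) :=
    tendsto_const_nhds.div_atTop ((tendsto_rpow_atTop (half_pos hs)).comp hnat)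
  have hθsq : ∀ n : ℕ, θ n ^ 2 = t ^ 2 / (n : ℝ) ^ s := fun n => by
    rw [hθ]
    simp only [div_pow]
    rw [← Real.rpow_natCast ((n : ℝ) ^ (s / 2)), ← Real.rpow_mul (Nat.cast_nonneg n)]
    norm_num
  have hKθ : Tendsto (fun n => (K n : ℝ) * θ n ^ 2) atTop (𝓝 (t ^ 2 * u)) := by
    refine (hKu.const_mul (t ^ 2)).congr fun n => ?_
    rw [hθsq]; ring
  have hpow : Tendsto (fun n => Complex.exp (-(θ n ^ 2 * κ / 2 : ℝ)) ^ K n) atTop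
      (𝓝 (Complex.exp (-(t ^ 2 * κ * u / 2 : ℝ)))) := by
    have h : Tendsto (fun n => Real.exp (-((K n : ℝ) * θ n ^ 2 * κ / 2))) atTop
        (𝓝 (Real.exp (-(t ^ 2 * u * κ / 2)))) :=
      (Real.continuous_exp.tendsto _).comp (((hKθ.mul_const κ).div_const 2).neg)
    have h' := (Complex.continuous_ofReal.tendsto _).comp h
    have e : Complex.exp (-(t ^ 2 * κ * u / 2 : ℝ))
        = ((Real.exp (-(t ^ 2 * u * κ / 2)) : ℝ) : ℂ) := by
      push_cast; ring_nf
    rw [e]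
    refine h'.congr fun n => ?_
    rw [← Complex.exp_nat_mul]
    simp only [Function.comp]
    push_cast
    ring_nf
  have hlog : Tendsto (fun n : ℕ => |θ n| * (1 + Real.log n)) atTop (𝓝 0) := by
    have h1 := (isLittleO_log_rpow_atTop (half_pos hs)).tendsto_div_nhds_zero.comp hnat
    have h2 := (h1.const_mul |t|).add hθ0.abs
    simp only [mul_zero, abs_zero, add_zero] at h2
    refine h2.congr fun n => ?_
    simp only [hθ, Function.comp, abs_div, abs_of_nonneg (Real.rpow_nonneg (Nat.cast_nonneg n) _)]
    ring
  have hcube : Tendsto (fun n : ℕ => (K n : ℝ) * |θ n| ^ 3) atTop (𝓝 0) := by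
    have h1 := hKθ.mul hθ0.abs
    simp only [abs_zero, mul_zero] at h1
    refine h1.congr fun n => ?_
    rw [← sq_abs (θ n)]; ring
  have herr : Tendsto (fun n : ℕ => A * (|θ n| * (1 + Real.log n) + (K n : ℝ) * |θ n| ^ 3)) atTop
      (𝓝 0) := by
    simpa using (hlog.add hcube).const_mul A
  have hdiff : Tendsto (fun n => ∏ j ∈ Finset.range (K n), twoPointCharFun a b c d x y (θ n) j
      - Complex.exp (-(θ n ^ 2 * κ / 2 : ℝ)) ^ K n) atTop (𝓝 0) := by
    have hsmall : ∀ᶠ n in atTop, |θ n| ≤ 1 := by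
      have := hθ0.abs
      rw [abs_zero] at this
      exact this.eventually_le_const one_pos
    refine squeeze_zero_norm' ?_ herr
    filter_upwards [hsmall] with n hn
    refine (norm_prod_sub_pow_le
      (fun j => norm_twoPointCharFun_le_one ha hb hc hd hab _ j) ?_ _).trans ?_
    · rw [← Complex.ofReal_neg, Complex.norm_exp_ofReal]
      exact Real.exp_le_one_iff.2 (neg_nonpos.2 (by positivity))
    · refine (Finset.sum_le_sum fun j _ => hbound (θ n) hn j).trans ?_
      rw [← Finset.mul_sum, Finset.sum_add_distrib, ← Finset.mul_sum, Finset.sum_const,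
        Finset.card_range, nsmul_eq_mul]
      gcongr
      -- Here `K n ≤ n` bounds the sum of the `1 / (j + 1)` by the `n`-th harmonic number.
      have h1 := harmonic_le_one_add_log n
      refine le_trans ?_ h1
      rw [harmonic]
      push_cast
      exact Finset.sum_le_sum_of_subset_of_nonneg (Finset.range_mono (hK n))
        (fun _ _ _ => by positivity)
  simpa using hdiff.add hpow

end TwoPoint

/-! ### Filtration and one-step averages for a general urn -/

namespace IsUrnProcess

variable {ι Ω : Type*} [Fintype ι] [mΩ : MeasurableSpace Ω] {R : Matrix ι ι ℝ} {c₀ : ι → ℝ}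
  {μ : Measure Ω} {draw : ℕ → Ω → ι} {C : ℕ → Ω → ι → ℝ}

/-- No σ-algebra is given on `ι`; finiteness of `ι` and measurability of the fibers of `draw n`
suffice for any `h`. -/
lemma measurable_comp_draw (hC : IsUrnProcess R c₀ μ draw C) {β : Type*} [MeasurableSpace β]
    (n : ℕ) (h : ι → β) : Measurable fun ω => h (draw n ω) := by
  intro A _
  have : (fun ω => h (draw n ω)) ⁻¹' A = ⋃ i ∈ h ⁻¹' A, draw n ⁻¹' {i} := by
    ext ω; simp
  rw [this]
  exact MeasurableSet.biUnion (Set.to_countable _) fun i _ => hC.measurableSet_draw n i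

lemma measurable_content (hC : IsUrnProcess R c₀ μ draw C) (n : ℕ) : Measurable (C n) := by
  induction n with
  | zero => rw [funext hC.zero]; exact measurable_const
  | succ n ih => rw [funext (hC.succ n)]; exact ih.add (hC.measurable_comp_draw n R)

lemma content_nonneg [DecidableEq ι] (hC : IsUrnProcess R c₀ μ draw C)
    (hR : R ∈ Matrix.rowStochastic ℝ ι) (hc₀ : c₀ ∈ stdSimplex ℝ ι) (n : ℕ) (ω : Ω) (i : ι) :
    0 ≤ C n ω i := by
  induction n with
  | zero => rw [hC.zero]; exact hc₀.1 i
  | succ n ih => rw [hC.succ]; exact add_nonneg ih (hR.1 _ _)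

lemma sum_content [DecidableEq ι] (hC : IsUrnProcess R c₀ μ draw C)
    (hR : R ∈ Matrix.rowStochastic ℝ ι) (hc₀ : c₀ ∈ stdSimplex ℝ ι) (n : ℕ) (ω : Ω) :
    ∑ i, C n ω i = n + 1 := by
  induction n with
  | zero => rw [hC.zero]; simpa using hc₀.2
  | succ n ih =>
    rw [hC.succ]
    simp only [Pi.add_apply, Finset.sum_add_distrib, ih,
      Matrix.sum_row_of_mem_rowStochastic hR]
    push_cast; ring

/-- The natural filtration of the urn content. -/
def filtration (hC : IsUrnProcess R c₀ μ draw C) : Filtration ℕ mΩ :=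
  Filtration.natural C fun n => (hC.measurable_content n).stronglyMeasurable

lemma measurable_content_filtration (hC : IsUrnProcess R c₀ μ draw C) (n : ℕ) :
    Measurable[hC.filtration n] (C n) :=
  measurable_iff_comap_le.2 (le_iSup₂_of_le n le_rfl le_rfl)

lemma measurable_content_dotProduct (hC : IsUrnProcess R c₀ μ draw C) (v : ι → ℝ) (n : ℕ) :
    Measurable[hC.filtration n] fun ω => C n ω ⬝ᵥ v := by
  simp only [dotProduct]
  exact Finset.measurable_sum _ fun i _ =>
    ((measurable_pi_apply i).comp (hC.measurable_content_filtration n)).mul_const _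

section CondExp

variable {E : Type*} [NormedAddCommGroup E] [NormedSpace ℝ E]

/-- Split according to the color drawn, then pull each `f i`, known at time `n`, out of the
conditional expectation. It serves real values for the martingale and complex ones for
characteristic functions. -/
lemma condExp_apply_draw [CompleteSpace E] [IsProbabilityMeasure μ]
    (hC : IsUrnProcess R c₀ μ draw C) (n : ℕ)
    {f : ι → Ω → E} (hfm : ∀ i, StronglyMeasurable[hC.filtration n] (f i))
    (hfi : ∀ i, Integrable (f i) μ) :
    μ[fun ω => f (draw n ω) ω | hC.filtration n]
      =ᵐ[μ] fun ω => ∑ i, (C n ω i / ((n : ℝ) + 1)) • f i ω := by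
  have h1 : (fun ω => f (draw n ω) ω)
      = ∑ i, (draw n ⁻¹' {i}).indicator (fun _ => (1 : ℝ)) • f i := by
    ext ω
    rw [Finset.sum_apply, Finset.sum_eq_single (draw n ω)]
    · simp
    · intro i _ hi
      simp [hi.symm]
    · simp
  have h0 : ∀ i, Integrable ((draw n ⁻¹' {i}).indicator (fun _ => (1 : ℝ)) • f i) μ := fun i => by
    refine ((hfi i).indicator (hC.measurableSet_draw n i)).congr (ae_of_all _ fun ω => ?_)
    by_cases h : ω ∈ draw n ⁻¹' {i} <;> simp [h]
  rw [h1]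
  refine (condExp_finsetSum (fun i _ => h0 i) _).trans ?_
  have h2 : ∀ i, μ[(draw n ⁻¹' {i}).indicator (fun _ => (1 : ℝ)) • f i | hC.filtration n]
      =ᵐ[μ] fun ω => (C n ω i / ((n : ℝ) + 1)) • f i ω := fun i => by
    refine (condExp_smul_of_aestronglyMeasurable_right
      ((integrable_const _).indicator (hC.measurableSet_draw n i))
      (h0 i) (hfm i).aestronglyMeasurable).trans ?_
    -- The σ-algebra in `condProb_draw` is by definition the one of the natural filtration at `n`.
    filter_upwards [hC.condProb_draw n i] with ω hω
    exact congrArg (· • f i ω) hω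
  filter_upwards [ae_all_iff.2 h2] with ω hω
  rw [Finset.sum_apply]
  exact Finset.sum_congr rfl fun i _ => hω i

lemma integral_apply_draw [CompleteSpace E] [IsProbabilityMeasure μ]
    (hC : IsUrnProcess R c₀ μ draw C) (n : ℕ)
    {f : ι → Ω → E} (hfm : ∀ i, StronglyMeasurable[hC.filtration n] (f i))
    (hfi : ∀ i, Integrable (f i) μ) :
    ∫ ω, f (draw n ω) ω ∂μ = ∫ ω, ∑ i, (C n ω i / ((n : ℝ) + 1)) • f i ω ∂μ := by
  rw [← integral_condExp (hC.filtration.le n)]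
  exact integral_congr_ae (hC.condExp_apply_draw n hfm hfi)

end CondExp

/-! ### The martingale of an eigenvector -/

section Martingale

variable [DecidableEq ι] [IsProbabilityMeasure μ]

lemma integrable_content_dotProduct (hC : IsUrnProcess R c₀ μ draw C)
    (hR : R ∈ Matrix.rowStochastic ℝ ι) (hc₀ : c₀ ∈ stdSimplex ℝ ι) (v : ι → ℝ) (n : ℕ) :
    Integrable (fun ω => C n ω ⬝ᵥ v) μ := by
  simp only [dotProduct]
  refine integrable_finsetSum _ fun i _ => Integrable.mul_const ?_ _
  refine Integrable.of_bound (C := (n : ℝ) + 1)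
    ((measurable_pi_apply i).comp (hC.measurable_content n)).aestronglyMeasurable
    (ae_of_all _ fun ω => ?_)
  rw [Real.norm_eq_abs, abs_of_nonneg (hC.content_nonneg hR hc₀ n ω i),
    ← hC.sum_content hR hc₀ n ω]
  exact Finset.single_le_sum (f := fun i => C n ω i)
    (fun j _ => hC.content_nonneg hR hc₀ n ω j) (Finset.mem_univ i)

lemma condExp_content_succ_dotProduct (hC : IsUrnProcess R c₀ μ draw C)
    (hR : R ∈ Matrix.rowStochastic ℝ ι) (hc₀ : c₀ ∈ stdSimplex ℝ ι) {v : ι → ℝ} {lam : ℝ}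
    (hv : R *ᵥ v = lam • v) (n : ℕ) :
    μ[fun ω => C (n + 1) ω ⬝ᵥ v | hC.filtration n]
      =ᵐ[μ] fun ω => (1 + lam / ((n : ℝ) + 1)) * (C n ω ⬝ᵥ v) := by
  have h1 : (fun ω => C (n + 1) ω ⬝ᵥ v)
      = fun ω => (fun i ω => C n ω ⬝ᵥ v + lam * v i) (draw n ω) ω := by
    ext ω
    have := congrFun hv (draw n ω)
    simp only [Matrix.mulVec, Pi.smul_apply, smul_eq_mul] at this
    rw [hC.succ, add_dotProduct, this]
  rw [h1]
  refine (hC.condExp_apply_draw n (f := fun i ω => C n ω ⬝ᵥ v + lam * v i)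
    (fun i => ((hC.measurable_content_dotProduct v n).add_const _).stronglyMeasurable)
    (fun i => (hC.integrable_content_dotProduct hR hc₀ v n).add (integrable_const _))).trans
    (ae_of_all _ fun ω => ?_)
  have hn : (n : ℝ) + 1 ≠ 0 := by positivity
  simp only [smul_eq_mul, mul_add, Finset.sum_add_distrib, ← Finset.sum_mul, ← Finset.sum_div,
    hC.sum_content hR hc₀ n ω, div_self hn]
  have : ∑ i, C n ω i / ((n : ℝ) + 1) * (lam * v i) = lam / ((n : ℝ) + 1) * (C n ω ⬝ᵥ v) := by
    rw [dotProduct, Finset.mul_sum]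
    exact Finset.sum_congr rfl fun i _ => by ring
  rw [this]; ring

/-- The product is `∏ (lam + j)` over `j ≤ n`, divided by `lam * n!`, so this is Euler's limit
formula for the Gamma function. -/
lemma tendsto_prod_one_add_div {lam : ℝ} (hlam : 0 < lam) :
    Tendsto (fun n : ℕ => (∏ k ∈ Finset.range n, (1 + lam / ((k : ℝ) + 1))) / (n : ℝ) ^ lam) atTop
      (𝓝 (lam * Real.Gamma lam)⁻¹) := by
  have h := ((Real.GammaSeq_tendsto_Gamma lam).const_mul lam).inv₀
    (mul_pos hlam (Real.Gamma_pos_of_pos hlam)).ne'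
  refine h.congr' ?_
  filter_upwards [eventually_gt_atTop 0] with n hn
  have e : ∀ n : ℕ, (∏ k ∈ Finset.range n, (1 + lam / ((k : ℝ) + 1))) * (lam * n.factorial)
      = ∏ j ∈ Finset.range (n + 1), (lam + j) := fun n => by
    induction n with
    | zero => simp
    | succ n ih =>
      rw [Finset.prod_range_succ _ (n + 1), ← ih, Finset.prod_range_succ, Nat.factorial_succ]
      push_cast
      field_simp
      ring
  have hf : (n.factorial : ℝ) ≠ 0 := by positivity
  have hp : (n : ℝ) ^ lam ≠ 0 := by positivity
  rw [Real.GammaSeq, ← e]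
  field_simp

/-- If `v ≥ 0` is a right eigenvector of `R` for the eigenvalue `lam > 0`, then `C n ⬝ᵥ v`, divided
by `n ^ lam`, converges almost surely. -/
lemma exists_tendsto_content_dotProduct_div_rpow (hC : IsUrnProcess R c₀ μ draw C)
    (hR : R ∈ Matrix.rowStochastic ℝ ι) (hc₀ : c₀ ∈ stdSimplex ℝ ι) {v : ι → ℝ} {lam : ℝ}
    (hlam : 0 < lam) (hv : R *ᵥ v = lam • v) (hv0 : ∀ i, 0 ≤ v i) :
    ∃ U : Ω → ℝ, Measurable U ∧
      ∀ᵐ ω ∂μ, Tendsto (fun n : ℕ => (C n ω ⬝ᵥ v) / (n : ℝ) ^ lam) atTop (𝓝 (U ω)) := by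
  -- `a n` is the growth factor of the mean of `C n ⬝ᵥ v`; dividing by it gives a martingale.
  set a : ℕ → ℝ := fun n => ∏ k ∈ Finset.range n, (1 + lam / ((k : ℝ) + 1)) with ha
  have ha0 : ∀ n, 0 < a n := fun n => Finset.prod_pos fun k _ => by positivity
  set M : ℕ → Ω → ℝ := fun n ω => (a n)⁻¹ * (C n ω ⬝ᵥ v) with hM
  have hMi : ∀ n, Integrable (M n) μ := fun n =>
    (hC.integrable_content_dotProduct hR hc₀ v n).const_mul _
  have hM0 : ∀ n ω, 0 ≤ M n ω := fun n ω => mul_nonneg (inv_nonneg.2 (ha0 n).le)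
    (Finset.sum_nonneg fun i _ => mul_nonneg (hC.content_nonneg hR hc₀ n ω i) (hv0 i))
  have hmart : Martingale M hC.filtration μ := by
    refine martingale_nat
      (fun n => ((hC.measurable_content_dotProduct v n).const_mul _).stronglyMeasurable) hMi
      fun n => ?_
    have h1 : M (n + 1) = (a (n + 1))⁻¹ • fun ω => C (n + 1) ω ⬝ᵥ v := rfl
    rw [h1]
    refine EventuallyEq.symm ((condExp_smul _ _ _).trans ?_)
    filter_upwards [hC.condExp_content_succ_dotProduct hR hc₀ hv n] with ω hω
    rw [Pi.smul_apply, hω, smul_eq_mul, hM]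
    have h2 : a (n + 1) = a n * (1 + lam / ((n : ℝ) + 1)) := Finset.prod_range_succ _ _
    have h3 : 0 < 1 + lam / ((n : ℝ) + 1) := by positivity
    have h4 := ha0 n
    simp only
    rw [h2]
    field_simp
  -- By nonnegativity the L¹ norm is the mean, which is constant; this bound gives almost sure
  -- convergence.
  have hbdd : ∀ n, eLpNorm (M n) 1 μ ≤ (Real.toNNReal (∫ ω, M 0 ω ∂μ) : ENNReal) := fun n => by
    have h1 : ∫ ω, M n ω ∂μ = ∫ ω, M 0 ω ∂μ := by
      have := hmart.setIntegral_eq (Nat.zero_le n) MeasurableSet.univ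
      simpa using this.symm
    rw [eLpNorm_one_eq_lintegral_enorm, ← h1]
    change _ ≤ ENNReal.ofReal _
    rw [ofReal_integral_eq_lintegral_ofReal (hMi n) (ae_of_all _ (hM0 n))]
    exact lintegral_mono fun ω => by rw [Real.enorm_of_nonneg (hM0 n ω)]
  refine ⟨fun ω => hC.filtration.limitProcess M μ ω * (lam * Real.Gamma lam)⁻¹,
    Filtration.stronglyMeasurable_limit_process'.measurable.mul_const _, ?_⟩
  filter_upwards [hmart.submartingale.ae_tendsto_limitProcess hbdd] with ω hω
  refine (hω.mul (tendsto_prod_one_add_div hlam)).congr fun n => ?_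
  have := (ha0 n).ne'
  simp only [hM]
  change (a n)⁻¹ * _ * (a n / _) = _
  field_simp

end Martingale

end IsUrnProcess

/-! ### The count of white and black draws -/

/-- The number of white and black balls drawn in the first `n` trials. -/
def leftCount {Ω : Type*} (draw : ℕ → Ω → Color) (n : ℕ) (ω : Ω) : ℕ :=
  ∑ k ∈ Finset.range n, if (draw k ω).isLeft then 1 else 0

section LeftCount

variable {Ω : Type*} {draw : ℕ → Ω → Color}

lemma leftCount_succ (n : ℕ) (ω : Ω) :
    leftCount draw (n + 1) ω = leftCount draw n ω + if (draw n ω).isLeft then 1 else 0 :=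
  Finset.sum_range_succ _ _

lemma leftCount_le (n : ℕ) (ω : Ω) : leftCount draw n ω ≤ n := by
  refine (Finset.sum_le_card_nsmul _ _ 1 fun k _ => ?_).trans (by simp)
  split_ifs <;> simp

end LeftCount

namespace IsUrnProcess

variable {Ω : Type*} [MeasurableSpace Ω] {R : Matrix Color Color ℝ} {c₀ : Color → ℝ}
  {μ : Measure Ω} {draw : ℕ → Ω → Color} {C : ℕ → Ω → Color → ℝ} {r : Fin 2 → ℝ}

lemma content_inl_eq (hC : IsUrnProcess R c₀ μ draw C)
    (hl : ∀ i j, R (Sum.inl i) (Sum.inl j) = r j) (hr : ∀ i j, R (Sum.inr i) (Sum.inl j) = 0)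
    (n : ℕ) (ω : Ω) (j : Fin 2) :
    C n ω (Sum.inl j) = c₀ (Sum.inl j) + r j * leftCount draw n ω := by
  induction n with
  | zero => simp [hC.zero, leftCount]
  | succ n ih =>
    rw [hC.succ, leftCount_succ, Pi.add_apply, ih]
    rcases draw n ω with i | i
    · simp [hl]; ring
    · simp [hr]

/-- The filtration is generated by the contents, not by the draws, so the count is recovered from
the white-black total. The floor only converts an exact integer to `ℕ`. -/
lemma measurable_leftCount (hC : IsUrnProcess R c₀ μ draw C)
    (hl : ∀ i j, R (Sum.inl i) (Sum.inl j) = r j) (hr : ∀ i j, R (Sum.inr i) (Sum.inl j) = 0)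
    (hrpos : 0 < r 0 + r 1) (n : ℕ) :
    Measurable[hC.filtration n] (leftCount draw n) := by
  have h : leftCount draw n = fun ω => ⌊(C n ω (Sum.inl 0) + C n ω (Sum.inl 1)
      - (c₀ (Sum.inl 0) + c₀ (Sum.inl 1))) / (r 0 + r 1)⌋₊ := by
    ext ω
    rw [hC.content_inl_eq hl hr, hC.content_inl_eq hl hr]
    have : (c₀ (Sum.inl 0) + r 0 * (leftCount draw n ω : ℝ)
        + (c₀ (Sum.inl 1) + r 1 * (leftCount draw n ω : ℝ))
        - (c₀ (Sum.inl 0) + c₀ (Sum.inl 1))) / (r 0 + r 1) = (leftCount draw n ω : ℝ) := by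
      field_simp
      ring
    rw [this, Nat.floor_natCast]
  have hm : ∀ i, Measurable[hC.filtration n] fun ω => C n ω i := fun i =>
    (measurable_pi_apply i).comp (hC.measurable_content_filtration n)
  rw [h]
  exact Nat.measurable_floor.comp
    ((((hm (Sum.inl 0)).add (hm (Sum.inl 1))).sub_const _).div_const _)

lemma stronglyMeasurable_mul_comp_leftCount (hC : IsUrnProcess R c₀ μ draw C)
    (hl : ∀ i j, R (Sum.inl i) (Sum.inl j) = r j) (hr : ∀ i j, R (Sum.inr i) (Sum.inl j) = 0)
    (hrpos : 0 < r 0 + r 1) (n : ℕ) {A : Ω → ℂ} (hA : Measurable[hC.filtration n] A)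
    (g : ℕ → ℂ) :
    StronglyMeasurable[hC.filtration n] fun ω => A ω * g (leftCount draw n ω) :=
  (hA.mul ((measurable_from_nat (f := g)).comp
    (hC.measurable_leftCount hl hr hrpos n))).stronglyMeasurable

lemma integrable_mul_comp_leftCount [IsProbabilityMeasure μ] (hC : IsUrnProcess R c₀ μ draw C)
    (hl : ∀ i j, R (Sum.inl i) (Sum.inl j) = r j) (hr : ∀ i j, R (Sum.inr i) (Sum.inl j) = 0)
    (hrpos : 0 < r 0 + r 1) (n : ℕ) {A : Ω → ℂ} (hA : Measurable[hC.filtration n] A)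
    (hA1 : ∀ ω, ‖A ω‖ ≤ 1) (g : ℕ → ℂ) :
    Integrable (fun ω => A ω * g (leftCount draw n ω)) μ := by
  refine Integrable.of_bound (C := ∑ j ∈ Finset.range (n + 1), ‖g j‖)
    ((hC.stronglyMeasurable_mul_comp_leftCount hl hr hrpos n hA g).mono
      (hC.filtration.le n)).aestronglyMeasurable (ae_of_all _ fun ω => ?_)
  rw [norm_mul]
  refine (mul_le_of_le_one_left (norm_nonneg _) (hA1 ω)).trans ?_
  exact Finset.single_le_sum (f := fun j => ‖g j‖) (fun _ _ => norm_nonneg _)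
    (Finset.mem_range.2 (Nat.lt_succ_of_le (leftCount_le n ω)))

/-- Averaging over the color drawn at trial `n + 1`, for a function of the history, of whether
that color is white or black, and of the factor `e` of the color. -/
lemma integral_mul_draw_eq [IsProbabilityMeasure μ] (hC : IsUrnProcess R c₀ μ draw C)
    (hR : R ∈ Matrix.rowStochastic ℝ Color) (hc₀ : c₀ ∈ stdSimplex ℝ Color)
    (hl : ∀ i j, R (Sum.inl i) (Sum.inl j) = r j) (hr : ∀ i j, R (Sum.inr i) (Sum.inl j) = 0)
    (hrpos : 0 < r 0 + r 1) (n : ℕ) {A : Ω → ℂ} (hA : Measurable[hC.filtration n] A)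
    (hA1 : ∀ ω, ‖A ω‖ ≤ 1) (e : Fin 2 → ℂ) (g : ℕ → ℂ) :
    ∫ ω, A ω * (Sum.elim e 1 (draw n ω) * g (leftCount draw (n + 1) ω)) ∂μ
      = ∫ ω, A ω *
        ((((c₀ (Sum.inl 0) + r 0 * leftCount draw n ω : ℝ) * e 0
              + (c₀ (Sum.inl 1) + r 1 * leftCount draw n ω : ℝ) * e 1) / (n + 1)
            * g (leftCount draw n ω + 1)
          + (1 - (c₀ (Sum.inl 0) + c₀ (Sum.inl 1) + (r 0 + r 1) * leftCount draw n ω : ℝ) / (n + 1))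
            * g (leftCount draw n ω))) ∂μ := by
  -- For a fixed color `i`, the count after the trial is a function of the history, so the integrand
  -- fits the one-step average.
  have h := hC.integral_apply_draw n
    (f := fun i ω => A ω * (fun m => Sum.elim e 1 i * g (m + if i.isLeft then 1 else 0))
      (leftCount draw n ω))
    (fun i => hC.stronglyMeasurable_mul_comp_leftCount hl hr hrpos n hA
      fun m => Sum.elim e 1 i * g (m + if i.isLeft then 1 else 0))
    (fun i => hC.integrable_mul_comp_leftCount hl hr hrpos n hA hA1
      fun m => Sum.elim e 1 i * g (m + if i.isLeft then 1 else 0))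
  simp only [← leftCount_succ] at h
  rw [h]
  congr 1
  ext ω
  have hsum := hC.sum_content hR hc₀ n ω
  simp only [Fintype.sum_sum_type, Fin.sum_univ_two, hC.content_inl_eq hl hr] at hsum ⊢
  -- Green and yellow enter with the same factor, so only their total counts; it is fixed by the
  -- white-black content.
  have hsum' : C n ω (Sum.inr 1) = n + 1 - (c₀ (Sum.inl 0) + c₀ (Sum.inl 1)
      + (r 0 + r 1) * leftCount draw n ω) - C n ω (Sum.inr 0) := by linarith
  rw [hsum']
  have hn : (n : ℂ) + 1 ≠ 0 := by exact_mod_cast (Nat.succ_ne_zero n)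
  simp only [Sum.elim_inl, Sum.elim_inr, Sum.isLeft_inl, Sum.isLeft_inr, Pi.one_apply,
    Complex.real_smul, if_true, Bool.false_eq_true, if_false, add_zero]
  push_cast
  field_simp
  ring

/-- This encodes, without conditioning on the draw times, that the colors of the white-black draws
are independent given those times. The arbitrary `g` closes the induction: a one-step average turns
a test function of the count into another one. -/
lemma integral_cexp_content_mul [IsProbabilityMeasure μ] (hC : IsUrnProcess R c₀ μ draw C)
    (hR : R ∈ Matrix.rowStochastic ℝ Color) (hc₀ : c₀ ∈ stdSimplex ℝ Color)
    (hc₀_pos : 0 < c₀ (Sum.inl 0) + c₀ (Sum.inl 1))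
    (hl : ∀ i j, R (Sum.inl i) (Sum.inl j) = r j) (hr : ∀ i j, R (Sum.inr i) (Sum.inl j) = 0)
    (hrpos : 0 < r 0 + r 1) {v : Color → ℝ} {ξ : Fin 2 → ℝ}
    (hv : R *ᵥ v = Sum.elim ξ 0) (θ : ℝ) (n : ℕ) (g : ℕ → ℂ) :
    ∫ ω, Complex.exp (θ * (C n ω ⬝ᵥ v : ℝ) * Complex.I) * g (leftCount draw n ω) ∂μ
      = Complex.exp (θ * (c₀ ⬝ᵥ v : ℝ) * Complex.I) *
        ∫ ω, (∏ j ∈ Finset.range (leftCount draw n ω),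
          twoPointCharFun (c₀ (Sum.inl 0)) (c₀ (Sum.inl 1)) (r 0) (r 1) (ξ 0) (ξ 1) θ j)
          * g (leftCount draw n ω) ∂μ := by
  induction n generalizing g with
  | zero =>
    simp [hC.zero, leftCount]
  | succ n ih =>
    set φ := twoPointCharFun (c₀ (Sum.inl 0)) (c₀ (Sum.inl 1)) (r 0) (r 1) (ξ 0) (ξ 1) θ with hφ
    set e : Fin 2 → ℂ := fun i => Complex.exp (θ * ξ i * Complex.I) with he
    have h1 : ∀ ω, Complex.exp (θ * (C (n + 1) ω ⬝ᵥ v : ℝ) * Complex.I)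
          * g (leftCount draw (n + 1) ω)
        = Complex.exp (θ * (C n ω ⬝ᵥ v : ℝ) * Complex.I)
          * (Sum.elim e 1 (draw n ω) * g (leftCount draw (n + 1) ω)) := fun ω => by
      have h2 : R (draw n ω) ⬝ᵥ v = Sum.elim ξ 0 (draw n ω) := congrFun hv (draw n ω)
      rw [hC.succ, add_dotProduct, h2, ← mul_assoc]
      congr 1
      rcases draw n ω with i | i
      · rw [Sum.elim_inl, Sum.elim_inl, he, ← Complex.exp_add]
        push_cast
        ring_nf
      · simp
    have hmeas : Measurable[hC.filtration n]
        fun ω => Complex.exp (θ * (C n ω ⬝ᵥ v : ℝ) * Complex.I) :=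
      Complex.measurable_exp.comp (((Complex.measurable_ofReal.comp
        (hC.measurable_content_dotProduct v n)).const_mul _).mul_const _)
    have hnorm : ∀ ω, ‖Complex.exp (θ * (C n ω ⬝ᵥ v : ℝ) * Complex.I)‖ ≤ 1 := fun ω => by
      rw [← Complex.ofReal_mul, Complex.norm_exp_ofReal_mul_I]
    simp_rw [h1]
    rw [hC.integral_mul_draw_eq hR hc₀ hl hr hrpos n hmeas hnorm e g]
    -- The same average for the count alone, with the product placed in the test function.
    have h3 := hC.integral_mul_draw_eq hR hc₀ hl hr hrpos n (A := 1) measurable_const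
      (by simp) 1 (fun m => (∏ j ∈ Finset.range m, φ j) * g m)
    have h4 : ∀ ω, Sum.elim (1 : Fin 2 → ℂ) (1 : Fin 2 → ℂ) (draw n ω) = 1 := fun ω => by
      rcases draw n ω with i | i <;> simp
    simp only [Pi.one_apply, one_mul, mul_one, h4] at h3
    rw [h3]
    refine (ih (fun m => ((c₀ (Sum.inl 0) + r 0 * m : ℝ) * e 0
              + (c₀ (Sum.inl 1) + r 1 * m : ℝ) * e 1) / (n + 1) * g (m + 1)
          + (1 - (c₀ (Sum.inl 0) + c₀ (Sum.inl 1) + (r 0 + r 1) * m : ℝ) / (n + 1)) * g m)).trans ?_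
    congr 2
    ext ω
    set m := leftCount draw n ω
    have hn : (n : ℂ) + 1 ≠ 0 := by exact_mod_cast (Nat.succ_ne_zero n)
    have hS : 0 < c₀ (Sum.inl 0) + c₀ (Sum.inl 1) + (r 0 + r 1) * (m : ℝ) := by positivity
    have hS' : ((c₀ (Sum.inl 0) + c₀ (Sum.inl 1) + (r 0 + r 1) * m : ℝ) : ℂ) ≠ 0 := by
      exact_mod_cast hS.ne'
    -- The color factors average to `φ m` times the total white-black weight; this `φ m` is the
    -- extra factor of the product over `m + 1` terms.
    have h5 : ((c₀ (Sum.inl 0) + r 0 * m : ℝ) * e 0 + (c₀ (Sum.inl 1) + r 1 * m : ℝ) * e 1 : ℂ)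
        = ((c₀ (Sum.inl 0) + r 0 * m : ℝ) + (c₀ (Sum.inl 1) + r 1 * m : ℝ) : ℂ) * φ m := by
      have h6 : ((c₀ (Sum.inl 0) + r 0 * m : ℝ) + (c₀ (Sum.inl 1) + r 1 * m : ℝ) : ℂ)
          = ((c₀ (Sum.inl 0) + c₀ (Sum.inl 1) + (r 0 + r 1) * m : ℝ) : ℂ) := by
        push_cast; ring
      rw [h6, hφ, twoPointCharFun, mul_div_cancel₀ _ hS']
    rw [h5, Finset.prod_range_succ]
    ring

end IsUrnProcess

/-! ### The mixed normal limit -/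

lemma charFun_map_sqrt_mul_gaussian {Ω : Type*} [MeasurableSpace Ω] {μ : Measure Ω}
    [IsProbabilityMeasure μ] {V : Ω → ℝ} (hV : Measurable V) (hV0 : ∀ᵐ ω ∂μ, 0 ≤ V ω) (t : ℝ) :
    charFun ((μ.prod (gaussianReal 0 1)).map fun p : Ω × ℝ => Real.sqrt (V p.1) * p.2) t
      = ∫ ω, Complex.exp (-(t ^ 2 * V ω / 2 : ℝ)) ∂μ := by
  have hm : Measurable fun p : Ω × ℝ => Real.sqrt (V p.1) * p.2 := by fun_prop
  rw [charFun_apply_real, integral_map hm.aemeasurable (by fun_prop), integral_prod]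
  · refine integral_congr_ae ?_
    filter_upwards [hV0] with ω hω
    have h := charFun_gaussianReal (μ := 0) (v := 1) (t * Real.sqrt (V ω))
    rw [charFun_apply_real] at h
    have h2 : (t * Real.sqrt (V ω)) ^ 2 = t ^ 2 * V ω := by rw [mul_pow, Real.sq_sqrt hω]
    calc _ = ∫ z : ℝ, Complex.exp ((t * Real.sqrt (V ω) : ℝ) * z * Complex.I)
          ∂(gaussianReal 0 1) := by
          congr 1; ext z; push_cast; ring_nf
      _ = _ := by
          rw [h, ← Complex.ofReal_pow, h2]
          push_cast
          simp
  · refine Integrable.of_bound (C := 1) (by fun_prop) (ae_of_all _ fun p => ?_)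
    rw [← Complex.ofReal_mul, Complex.norm_exp_ofReal_mul_I]

theorem proposition4p5
    (s : ℝ) (hs0 : 0 < s) (hs1 : s < 1)
    (Q E P : Matrix (Fin 2) (Fin 2) ℝ)
    (hQ : Q ∈ Matrix.rowStochastic ℝ (Fin 2)) (hQirr : Q.IsIrreducible)
    (hP : P ∈ Matrix.rowStochastic ℝ (Fin 2)) (hPirr : P.IsIrreducible)
    (hR : replacementMatrix s Q E P ∈ Matrix.rowStochastic ℝ Color)
    -- `R` is not diagonalizable, and its repeated eigenvalue is zero
    (hdiag : ¬ IsDiagonalizable (replacementMatrix s Q E P))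
    (hzero : 1 < (replacementMatrix s Q E P).charpoly.rootMultiplicity 0)
    -- a Jordan decomposition `R T = T J`, with second column `(ξ, 0)`
    (T : Matrix Color Color ℝ) (hT : IsUnit T)
    (hJordan : replacementMatrix s Q E P * T = T * jordanForm s)
    (ξ : Fin 2 → ℝ) (hξ : Module.End.HasEigenvector (Matrix.toLin' Q) 0 ξ)
    (hTξ : T.col (Sum.inl 1) = Sum.elim ξ 0)
    (πQ : Fin 2 → ℝ) (hπQ : IsStationaryDistribution Q πQ)
    -- the urn, with a positive initial amount of white and black
    (c₀ : Color → ℝ) (hc₀ : c₀ ∈ stdSimplex ℝ Color)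
    (hc₀_pos : 0 < c₀ (Sum.inl 0) + c₀ (Sum.inl 1))
    {Ω : Type*} [MeasurableSpace Ω] (μ : Measure Ω) [IsProbabilityMeasure μ]
    (draw : ℕ → Ω → Color) (C : ℕ → Ω → Color → ℝ)
    (hC : IsUrnProcess (replacementMatrix s Q E P) c₀ μ draw C) :
    ∃ U : Ω → ℝ, Measurable U ∧
      (∀ᵐ ω ∂μ, Tendsto
        (fun n : ℕ => (C n ω (Sum.inl 0) + C n ω (Sum.inl 1)) / (n : ℝ) ^ s) atTop (𝓝 (U ω))) ∧
      -- the limit law is that of `√V * Z`, with `V` the random variance and `Z` an independent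
      -- standard normal variable
      TendstoInDistribution
        (fun (n : ℕ) ω => (C n ω ⬝ᵥ T.col (Sum.inr 0)) / (n : ℝ) ^ (s / 2)) atTop
        (fun p : Ω × ℝ => Real.sqrt ((∑ i, πQ i * ξ i ^ 2) * U p.1 / s) * p.2)
        (fun _ => μ) (μ.prod (gaussianReal 0 1)) := by
  obtain ⟨hrow, hmean⟩ := stochastic_row_eq_stationary hQ hξ hπQ
  have hπ0 : ∀ i, 0 ≤ πQ i := hπQ.1.1
  have hπ1 : πQ 0 + πQ 1 = 1 := by simpa using hπQ.1.2
  have hl : ∀ i j, replacementMatrix s Q E P (Sum.inl i) (Sum.inl j) = (s • πQ) j := fun i j => by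
    simp [replacementMatrix, hrow]
  have hr : ∀ i j, replacementMatrix s Q E P (Sum.inr i) (Sum.inl j) = 0 := fun i j => by
    simp [replacementMatrix]
  have hr0 : ∀ i, 0 ≤ (s • πQ) i := fun i => mul_nonneg hs0.le (hπ0 i)
  have hrs : (s • πQ) 0 + (s • πQ) 1 = s := by
    rw [Pi.smul_apply, Pi.smul_apply, ← smul_add, hπ1, smul_eq_mul, mul_one]
  have hrpos : 0 < (s • πQ) 0 + (s • πQ) 1 := by rwa [hrs]
  have hv := (mulVec_jordan_col hJordan).trans hTξ
  -- The indicator of white and black is the eigenvector whose martingale yields `U`.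
  have hone : replacementMatrix s Q E P *ᵥ Sum.elim 1 0 = s • (Sum.elim 1 0 : Color → ℝ) := by
    ext i
    rcases i with i | i
    · simpa [Matrix.mulVec, dotProduct, hl] using hrs
    · simp [Matrix.mulVec, dotProduct, hr]
  obtain ⟨U, hUm, hU⟩ := hC.exists_tendsto_content_dotProduct_div_rpow hR hc₀ hs0 hone (by
    rintro (i | i) <;> simp)
  have hU' : ∀ᵐ ω ∂μ, Tendsto
      (fun n : ℕ => (C n ω (Sum.inl 0) + C n ω (Sum.inl 1)) / (n : ℝ) ^ s) atTop (𝓝 (U ω)) := by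
    simpa [dotProduct] using hU
  refine ⟨U, hUm, hU', ?_⟩
  have hU0 : ∀ᵐ ω ∂μ, 0 ≤ U ω := by
    filter_upwards [hU'] with ω hω
    refine ge_of_tendsto' hω fun n => div_nonneg (add_nonneg ?_ ?_) (by positivity)
    · exact hC.content_nonneg hR hc₀ n ω _
    · exact hC.content_nonneg hR hc₀ n ω _
  -- The white-black content is its initial value plus `s` times the count.
  have hKU : ∀ᵐ ω ∂μ, Tendsto (fun n : ℕ => (leftCount draw n ω : ℝ) / (n : ℝ) ^ s) atTop
      (𝓝 (U ω / s)) := by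
    filter_upwards [hU'] with ω hω
    have h0 : Tendsto (fun n : ℕ => (c₀ (Sum.inl 0) + c₀ (Sum.inl 1)) / (n : ℝ) ^ s) atTop (𝓝 0) :=
      tendsto_const_nhds.div_atTop ((tendsto_rpow_atTop hs0).comp tendsto_natCast_atTop_atTop)
    have h1 := (hω.sub h0).div_const s
    rw [sub_zero] at h1
    refine h1.congr fun n => ?_
    rw [hC.content_inl_eq hl hr, hC.content_inl_eq hl hr, ← sub_div, div_right_comm]
    congr 1
    field_simp
    linear_combination (leftCount draw n ω : ℝ) * hrs
  set κ := ∑ i, πQ i * ξ i ^ 2 with hκ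
  have hκ0 : 0 ≤ κ := Finset.sum_nonneg fun i _ => mul_nonneg (hπ0 i) (sq_nonneg _)
  have hκ' : ((s • πQ) 0 * ξ 0 ^ 2 + (s • πQ) 1 * ξ 1 ^ 2) / ((s • πQ) 0 + (s • πQ) 1) = κ := by
    rw [hrs, hκ, Fin.sum_univ_two]
    simp only [Pi.smul_apply, smul_eq_mul]
    field_simp
  have hmean' : (s • πQ) 0 * ξ 0 + (s • πQ) 1 * ξ 1 = 0 := by
    rw [dotProduct, Fin.sum_univ_two] at hmean
    simp only [Pi.smul_apply, smul_eq_mul]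
    linear_combination s * hmean
  have hXm : ∀ n : ℕ, Measurable fun ω => (C n ω ⬝ᵥ T.col (Sum.inr 0)) / (n : ℝ) ^ (s / 2) :=
    fun n => ((hC.measurable_content_dotProduct _ n).mono (hC.filtration.le n) le_rfl).div_const _
  have hVm : Measurable fun ω => κ * U ω / s := (hUm.const_mul _).div_const _
  refine ⟨fun n => (hXm n).aemeasurable, by fun_prop, ?_⟩
  refine ProbabilityMeasure.tendsto_iff_tendsto_charFun.2 fun t => ?_
  have hlim := charFun_map_sqrt_mul_gaussian (μ := μ) hVm (by
    filter_upwards [hU0] with ω hω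
    positivity) t
  have hchar : ∀ n : ℕ,
      charFun (μ.map fun ω => (C n ω ⬝ᵥ T.col (Sum.inr 0)) / (n : ℝ) ^ (s / 2)) t
        = Complex.exp ((t / (n : ℝ) ^ (s / 2) : ℝ) * (c₀ ⬝ᵥ T.col (Sum.inr 0) : ℝ) * Complex.I) *
          ∫ ω, ∏ j ∈ Finset.range (leftCount draw n ω),
            twoPointCharFun (c₀ (Sum.inl 0)) (c₀ (Sum.inl 1)) ((s • πQ) 0) ((s • πQ) 1)
              (ξ 0) (ξ 1) (t / (n : ℝ) ^ (s / 2)) j ∂μ := fun n => by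
    have h := hC.integral_cexp_content_mul hR hc₀ hc₀_pos hl hr hrpos hv
      (t / (n : ℝ) ^ (s / 2)) n 1
    simp only [Pi.one_apply, mul_one] at h
    rw [← h, charFun_apply_real, integral_map (hXm n).aemeasurable (by fun_prop)]
    congr 1
    ext ω
    push_cast
    ring_nf
  -- The initial content contributes only a phase, trivial in the limit.
  have hexp : Tendsto (fun n : ℕ => Complex.exp
      ((t / (n : ℝ) ^ (s / 2) : ℝ) * (c₀ ⬝ᵥ T.col (Sum.inr 0) : ℝ) * Complex.I)) atTop (𝓝 1) := by
    have h0 : Tendsto (fun n : ℕ => t / (n : ℝ) ^ (s / 2)) atTop (𝓝 0) :=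
      tendsto_const_nhds.div_atTop
        ((tendsto_rpow_atTop (half_pos hs0)).comp tendsto_natCast_atTop_atTop)
    have h1 := (Complex.continuous_exp.tendsto _).comp
      ((((Complex.continuous_ofReal.tendsto _).comp h0).mul_const
        ((c₀ ⬝ᵥ T.col (Sum.inr 0) : ℝ) : ℂ)).mul_const Complex.I)
    simpa [Function.comp_def] using h1
  have hint : Tendsto (fun n : ℕ => ∫ ω, ∏ j ∈ Finset.range (leftCount draw n ω),
      twoPointCharFun (c₀ (Sum.inl 0)) (c₀ (Sum.inl 1)) ((s • πQ) 0) ((s • πQ) 1)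
        (ξ 0) (ξ 1) (t / (n : ℝ) ^ (s / 2)) j ∂μ) atTop
      (𝓝 (∫ ω, Complex.exp (-(t ^ 2 * (κ * U ω / s) / 2 : ℝ)) ∂μ)) := by
    -- Each factor has norm at most 1, so the constant 1 dominates the products.
    refine tendsto_integral_of_dominated_convergence (fun _ => 1) (fun n => ?_)
      (integrable_const _) (fun n => ae_of_all _ fun ω => ?_) ?_
    · have h := (hC.stronglyMeasurable_mul_comp_leftCount hl hr hrpos n (A := 1) measurable_const
        (fun m => ∏ j ∈ Finset.range m, twoPointCharFun (c₀ (Sum.inl 0)) (c₀ (Sum.inl 1))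
          ((s • πQ) 0) ((s • πQ) 1) (ξ 0) (ξ 1) (t / (n : ℝ) ^ (s / 2)) j)).mono
        (hC.filtration.le n)
      simpa using h.aestronglyMeasurable
    · rw [norm_prod]
      exact Finset.prod_le_one (fun _ _ => norm_nonneg _) fun j _ =>
        norm_twoPointCharFun_le_one (hc₀.1 _) (hc₀.1 _) (hr0 0) (hr0 1) hc₀_pos _ j
    · filter_upwards [hKU] with ω hω
      have h := tendsto_prod_twoPointCharFun (hc₀.1 (Sum.inl 0)) (hc₀.1 (Sum.inl 1)) (hr0 0)
        (hr0 1) hc₀_pos hrpos hmean' hs0 (fun n => leftCount_le (draw := draw) n ω) hω t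
      rw [hκ'] at h
      have e : t ^ 2 * (κ * U ω / s) / 2 = t ^ 2 * κ * (U ω / s) / 2 := by ring
      rwa [e]
  have hfinal := hexp.mul hint
  rw [one_mul] at hfinal
  change Tendsto (fun n : ℕ => charFun
    (μ.map fun ω => (C n ω ⬝ᵥ T.col (Sum.inr 0)) / (n : ℝ) ^ (s / 2)) t) atTop (𝓝 (charFun
      ((μ.prod (gaussianReal 0 1)).map fun p : Ω × ℝ => Real.sqrt (κ * U p.1 / s) * p.2) t))
  rw [hlim]
  exact hfinal.congr fun n => (hchar n).symm
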